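/- Let $f:\mathbb{C}\to\mathbb{C}$ be a transcendental entire function (entire and not a polynomial). For $r>0$ put $M(r)=\max_{|z|=r}|f(z)|$, and let $R>0$ be such that $M(r)>r$ for all $r\ge R$. Write $f^n$ and $M^n$ for the $n$th iterates of $f$ and of $r\mapsto M(r)$, and put $$A_R(f)=\{z\in\mathbb{C}: |f^n(z)|\ge M^n(R)\text{ for all } n\ge 0\},$$ $$A(f)=\{z\in\mathbb{C}: \text{there is } L\in\mathbb{N}\text{ such that } |f^{n+L}(z)|\ge M^n(R)\text{ for all } n\ge 0\},$$ and $A(f)^c=\mathbb{C}\setminus A(f)$. Let $J(f)$ be the Julia set of $f$, that is, the set of points having no neighbourhood on which the iterates $(f^n)_{n\ge 0}$ form a normal family (locally uniform limits equal to $\infty$ being allowed). A set $E\subset\mathbb{C}$ is called a spider's web if $E$ is connected and there are bounded simply connected domains $G_0\subset G_1\subset G_2\subset\cdots$ with $\partial G_n\subset E$ for all $n$ and $\bigcup_n G_n=\mathbb{C}$. **Theorem.** Suppose that $A_R(f)$ is a spider's web. Then: (a) every connected component of $A(f)^c$ is compact; (b) every point of $J(f)$ is the limit of a sequence of points of $A(f)^c$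 that lie in pairwise distinct components of $A(f)^c$. -/

import Mathlib

open Filter Topology

noncomputable section

/-- A transcendental entire function: holomorphic on `ℂ` and not a polynomial function. -/
def IsTranscendentalEntire (f : ℂ → ℂ) : Prop :=
  Differentiable ℂ f ∧ ¬ ∃ p : Polynomial ℂ, ∀ z, f z = p.eval z

/-- The maximum modulus `M(r, f) = max_{|z| = r} |f(z)|`, used for `r > 0` and `f` entire, where
the supremum is attained. Its iterate `M^n(R, f)` is written `(maxModulus f)^[n] R`. -/
def maxModulus (f : ℂ → ℂ) (r : ℝ) : ℝ :=
  sSup ((fun z => ‖f z‖) '' Metric.sphere (0 : ℂ) r)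

/-- The set `A_R(f)` of points `z` with `|f^n(z)| ≥ M^n(R, f)` for all `n ≥ 0`. -/
def levelSet (f : ℂ → ℂ) (R : ℝ) : Set ℂ :=
  {z | ∀ n : ℕ, (maxModulus f)^[n] R ≤ ‖f^[n] z‖}

/-- The fast escaping set `A(f)`: there is `L ∈ ℕ` with `|f^{n+L}(z)| ≥ M^n(R, f)` for all
`n ≥ 0`. Here `R > 0` is any number such that `M(r, f) > r` for all `r ≥ R`. -/
def fastEscapingSet (f : ℂ → ℂ) (R : ℝ) : Set ℂ :=
  {z | ∃ L : ℕ, ∀ n : ℕ, (maxModulus f)^[n] R ≤ ‖f^[n + L] z‖}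

/-- Locally uniform convergence to `∞` on the open set `U`. -/
def TendstoInftyLocallyUniformlyOn (u : ℕ → ℂ → ℂ) (U : Set ℂ) : Prop :=
  ∀ K ⊆ U, IsCompact K → ∀ C : ℝ, ∀ᶠ k in atTop, ∀ z ∈ K, C ≤ ‖u k z‖

/-- Normality (in the sense of Montel) on `U` of a family of holomorphic functions: every sequence
of members of the family has a subsequence that converges locally uniformly on `U`, either to a
finite limit function or to `∞`. -/
def IsNormalFamilyOn (F : ℕ → ℂ → ℂ) (U : Set ℂ) : Prop :=
  ∀ φ : ℕ → ℕ, ∃ ψ : ℕ → ℕ, StrictMono ψ ∧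
    ((∃ g : ℂ → ℂ, TendstoLocallyUniformlyOn (fun k => F (φ (ψ k))) g atTop U) ∨
      TendstoInftyLocallyUniformlyOn (fun k => F (φ (ψ k))) U)

/-- The Fatou set: points having a neighbourhood on which the iterates of `f` form a normal
family. -/
def fatouSet (f : ℂ → ℂ) : Set ℂ :=
  {z | ∃ U : Set ℂ, IsOpen U ∧ z ∈ U ∧ IsNormalFamilyOn (fun n => f^[n]) U}

/-- The Julia set, the complement of the Fatou set. -/
def juliaSet (f : ℂ → ℂ) : Set ℂ := (fatouSet f)ᶜ

/-- An (infinite) spider's web: a connected set `E` for which there is an increasing sequence of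
bounded simply connected domains with boundaries in `E` and union `ℂ`. -/
def IsSpidersWeb (E : Set ℂ) : Prop :=
  IsConnected E ∧ ∃ G : ℕ → Set ℂ,
    (∀ n, IsOpen (G n) ∧ Bornology.IsBounded (G n) ∧ IsSimplyConnected (G n)) ∧
    (∀ n, G n ⊆ G (n + 1)) ∧
    (∀ n, frontier (G n) ⊆ E) ∧
    (⋃ n, G n) = Set.univ

end

/-! Let H_n be the component containing 0 of the complement of A_{M^n(R)}(f) (`fundamentalHole`).
The spider's web makes every H_n bounded, and f maps H_n onto H_{n+1} (`image_fundamentalHole`). The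
boundaries of the H_n lie in A(f), so a connected subset of A(f)^c that meets H_n lies inside it.
Moreover z lies in A(f) exactly when, for some L, f^{n+L}(z) avoids H_n for all n.

For (a), a component K of A(f)^c is trapped in some hole, hence bounded. If a limit point of K were
fast escaping, then, because the closure of H_n lies in H_{n+m} with m independent of n, all of K
would be fast escaping. So K is closed.

For (b), A(f)^c is unbounded, so by (a) it has infinitely many components. Near a Julia point,
Montel's theorem makes a single iterate hit all but at most one of any prescribed finite list of
points from distinct components. The preimages lie in distinct components, since iterates map
components into components. Montel's theorem is derived from Bloch's theorem through Schottky's. -/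

/-! ### Holomorphic lifts and the theorems of Bloch, Schottky and Montel -/

open Metric in
theorem exists_exp_eq_on_ball {f : ℂ → ℂ} {c : ℂ} {r : ℝ} (hr : 0 < r)
    (hf : DifferentiableOn ℂ f (ball c r)) (h0 : ∀ z ∈ ball c r, f z ≠ 0) :
    ∃ g : ℂ → ℂ, DifferentiableOn ℂ g (ball c r) ∧ ∀ z ∈ ball c r, Complex.exp (g z) = f z := by
  have hd : DifferentiableOn ℂ (fun z => deriv f z / f z) (ball c r) :=
    (hf.deriv isOpen_ball).div hf h0
  obtain ⟨g, hgc, hg⟩ := hd.isExactOn_ball.with_val_at c (Complex.log (f c))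
  have hgd : DifferentiableOn ℂ g (ball c r) := fun z hz =>
    (hg z hz).differentiableAt.differentiableWithinAt
  refine ⟨g, hgd, fun z hz => ?_⟩
  have hc : c ∈ ball c r := mem_ball_self hr
  have hder : ∀ w ∈ ball c r, HasDerivAt (fun z => f z * Complex.exp (-g z)) 0 w := by
    intro w hw
    have h1 : HasDerivAt f (deriv f w) w :=
      ((hf w hw).differentiableAt (isOpen_ball.mem_nhds hw)).hasDerivAt
    have h2 := h1.mul (hg w hw).neg.cexp
    refine h2.congr_deriv ?_
    have := h0 w hw
    field_simp
    ring
  have hconst := (convex_ball c r).isPreconnected |> fun hp =>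
    isOpen_ball.is_const_of_deriv_eq_zero hp
      (fun w hw => (hder w hw).differentiableAt.differentiableWithinAt)
      (fun w hw => (hder w hw).deriv) hz hc
  simp only [hgc, Complex.exp_neg, Complex.exp_log (h0 c hc), mul_inv_cancel₀ (h0 c hc)] at hconst
  exact (eq_of_mul_inv_eq_one hconst).symm

theorem abs_im_le_norm_cos (z : ℂ) : |z.im| ≤ ‖Complex.cos z‖ := by
  have h1 : ‖Complex.exp (z * Complex.I)‖ = Real.exp (-z.im) := by
    rw [Complex.norm_exp]; simp
  have h2 : ‖Complex.exp (-z * Complex.I)‖ = Real.exp z.im := by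
    rw [Complex.norm_exp]; simp
  have h3 : ‖Complex.cos z‖ = ‖Complex.exp (z * Complex.I) + Complex.exp (-z * Complex.I)‖ / 2 := by
    rw [Complex.cos, norm_div]; simp
  have h4 := abs_norm_sub_norm_le (Complex.exp (-z * Complex.I)) (-Complex.exp (z * Complex.I))
  rw [norm_neg, h1, h2, sub_neg_eq_add, add_comm (Complex.exp _)] at h4
  have h5 : |z.im| ≤ |Real.sinh z.im| := by
    rw [Real.abs_sinh]
    exact Real.self_le_sinh_iff.2 (abs_nonneg _)
  rw [Real.sinh_eq, abs_div, abs_two] at h5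
  rw [h3]
  linarith

theorem norm_cos_le_exp_norm (z : ℂ) : ‖Complex.cos z‖ ≤ Real.exp ‖z‖ := by
  rw [Complex.cos, norm_div]
  have h1 : ‖Complex.exp (z * Complex.I)‖ ≤ Real.exp ‖z‖ :=
    (Complex.norm_exp_le_exp_norm _).trans (by simp)
  have h2 : ‖Complex.exp (-z * Complex.I)‖ ≤ Real.exp ‖z‖ :=
    (Complex.norm_exp_le_exp_norm _).trans (by simp)
  have h3 := norm_add_le (Complex.exp (z * Complex.I)) (Complex.exp (-z * Complex.I))
  rw [Complex.norm_two]
  linarith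

-- If s is a square root of f² - 1, then (f + s)(f - s) = 1, so f + s = e^G and f = cosh G =
-- cos(-iG). Subtracting a multiple of 2π brings the real part at the centre into [-π, π];
-- `abs_im_le_norm_cos` bounds the imaginary part there.
open Metric in
theorem exists_cos_eq_on_ball {f : ℂ → ℂ} {c : ℂ} {r : ℝ} (hr : 0 < r)
    (hf : DifferentiableOn ℂ f (ball c r)) (h1 : ∀ z ∈ ball c r, f z ≠ 1)
    (h2 : ∀ z ∈ ball c r, f z ≠ -1) :
    ∃ g : ℂ → ℂ, DifferentiableOn ℂ g (ball c r) ∧ (∀ z ∈ ball c r, Complex.cos (g z) = f z) ∧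
      ‖g c‖ ≤ Real.pi + ‖f c‖ := by
  obtain ⟨l, hl, hle⟩ := exists_exp_eq_on_ball (f := fun z => f z ^ 2 - 1) hr
    ((hf.pow 2).sub_const 1) (by
      intro z hz h
      have : (f z - 1) * (f z + 1) = 0 := by linear_combination h
      rcases mul_eq_zero.1 this with h | h
      · exact h1 z hz (sub_eq_zero.1 h)
      · exact h2 z hz (eq_neg_of_add_eq_zero_left h))
  have hs : ∀ z ∈ ball c r, (f z + Complex.exp (l z / 2)) * (f z - Complex.exp (l z / 2)) = 1 := by
    intro z hz
    have h3 : Complex.exp (l z / 2) * Complex.exp (l z / 2) = f z ^ 2 - 1 := by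
      rw [← Complex.exp_add, add_halves, hle z hz]
    linear_combination -h3
  obtain ⟨G, hG, hGe⟩ := exists_exp_eq_on_ball (f := fun z => f z + Complex.exp (l z / 2)) hr
    (hf.add (hl.div_const 2).cexp) (fun z hz h => by simpa [h] using hs z hz)
  set k : ℤ := round ((G c).im / (2 * Real.pi)) with hk
  have hcos : ∀ z ∈ ball c r, Complex.cos (-Complex.I * G z - k * (2 * Real.pi)) = f z := by
    intro z hz
    rw [Complex.cos_sub_int_mul_two_pi, Complex.cos]
    have e1 : -Complex.I * G z * Complex.I = G z := by
      linear_combination (-G z) * Complex.I_mul_I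
    have e2 : -(-Complex.I * G z) * Complex.I = -G z := by
      linear_combination G z * Complex.I_mul_I
    rw [e1, e2, Complex.exp_neg, hGe z hz, inv_eq_of_mul_eq_one_right (hs z hz)]
    ring
  refine ⟨fun z => -Complex.I * G z - k * (2 * Real.pi), (hG.const_mul _).sub_const _, hcos, ?_⟩
  have him := abs_im_le_norm_cos (-Complex.I * G c - k * (2 * Real.pi))
  rw [hcos c (mem_ball_self hr)] at him
  have hre : |(-Complex.I * G c - k * (2 * Real.pi)).re| ≤ Real.pi := by
    have e : (-Complex.I * G c - k * (2 * Real.pi)).re =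
        ((G c).im / (2 * Real.pi) - k) * (2 * Real.pi) := by
      have : (2 * Real.pi) ≠ 0 := by positivity
      simp
      field_simp
    rw [e, abs_mul, abs_of_pos (by positivity : 0 < 2 * Real.pi)]
    have := abs_sub_round ((G c).im / (2 * Real.pi))
    nlinarith [Real.pi_pos]
  exact (Complex.norm_le_abs_re_add_abs_im _).trans (by linarith)

-- The Schwarz lemma applied to g' keeps it within |g'(a)|/2 of g'(a) on the disc of radius t/8.
-- Hence |g - g(a)| ≥ t|g'(a)|/16 on the boundary circle, and the quantitative open mapping theorem
-- costs another factor 2.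
open Metric in
theorem ball_subset_image_of_norm_deriv_le {g : ℂ → ℂ} {a : ℂ} {t : ℝ} (ht : 0 < t)
    (hg : DifferentiableOn ℂ g (ball a t))
    (hb : ∀ z ∈ ball a t, ‖deriv g z‖ ≤ 2 * ‖deriv g a‖) :
    ball (g a) (t * ‖deriv g a‖ / 32) ⊆ g '' ball a t := by
  rcases (norm_nonneg (deriv g a)).eq_or_lt with h0 | h0
  · simp [← h0]
  set d := ‖deriv g a‖ with hd
  have hat : a ∈ ball a t := mem_ball_self ht
  have hmaps : Set.MapsTo (deriv g) (ball a t) (ball (deriv g a) (4 * d)) := by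
    intro z hz
    rw [mem_ball, dist_eq_norm]
    have := norm_sub_le (deriv g z) (deriv g a)
    linarith [hb z hz]
  have hsub : closedBall a (t / 8) ⊆ ball a t := closedBall_subset_ball (by linarith)
  have hclose : ∀ z ∈ closedBall a (t / 8), ‖deriv g z - deriv g a‖ ≤ d / 2 := by
    intro z hz
    have h1 := Complex.dist_le_div_mul_dist_of_mapsTo_ball (hg.deriv isOpen_ball)
      (hmaps.mono_right ball_subset_closedBall)
      (hsub hz)
    rw [dist_eq_norm] at h1
    refine h1.trans ?_
    rw [mem_closedBall] at hz
    calc 4 * d / t * dist z a ≤ 4 * d / t * (t / 8) := by gcongr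
      _ = d / 2 := by field_simp; norm_num
  have hat8 : a ∈ closedBall a (t / 8) := mem_closedBall_self (by positivity)
  have hlin : ∀ z ∈ closedBall a (t / 8), ‖(g z - deriv g a * z) - (g a - deriv g a * a)‖ ≤
      d / 2 * ‖z - a‖ := by
    intro z hz
    refine (convex_closedBall a (t / 8)).norm_image_sub_le_of_norm_hasDerivWithin_le
      (f := fun z => g z - deriv g a * z) (f' := fun z => deriv g z - deriv g a) ?_ hclose hat8 hz
    intro w hw
    have := ((hg w (hsub hw)).differentiableAt (isOpen_ball.mem_nhds (hsub hw))).hasDerivAt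
    simpa using! (this.sub ((hasDerivAt_id w).const_mul (deriv g a))).hasDerivWithinAt
  have hsph : ∀ z ∈ sphere a (t / 8), t * d / 16 ≤ ‖g z - g a‖ := by
    intro z hz
    have h1 := hlin z (sphere_subset_closedBall hz)
    have h2 : ‖z - a‖ = t / 8 := by simpa [dist_eq_norm] using hz
    have h3 : ‖deriv g a * (z - a)‖ = d * (t / 8) := by rw [norm_mul, h2]
    have h4 := norm_sub_norm_le (deriv g a * (z - a)) (g z - g a)
    have h5 : ‖deriv g a * (z - a) - (g z - g a)‖ =
        ‖(g z - deriv g a * z) - (g a - deriv g a * a)‖ := by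
      rw [← norm_neg]; congr 1; ring
    rw [h5, h3] at h4
    rw [h2] at h1
    linarith
  have hne : ∃ᶠ z in 𝓝 a, g z ≠ g a := by
    have := ((hg a hat).differentiableAt (isOpen_ball.mem_nhds hat)).hasDerivAt
    have h2 := this.eventually_ne (c := g a) (norm_pos_iff.1 h0)
    exact h2.frequently.filter_mono nhdsWithin_le_nhds
  have hcl : DiffContOnCl ℂ g (ball a (t / 8)) :=
    (hg.mono hsub).diffContOnCl_ball Set.Subset.rfl
  have := hcl.ball_subset_image_closedBall (by positivity) hsph hne
  have e : t * d / 16 / 2 = t * d / 32 := by ring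
  rw [e] at this
  exact this.trans (Set.image_mono hsub)

open Metric in
/-- A weak form of **Bloch's theorem**. -/
theorem norm_deriv_mul_le_of_forall_not_ball_subset {g : ℂ → ℂ} {c : ℂ} {r K : ℝ} (hr : 0 < r)
    (hK : 0 ≤ K) (hg : DifferentiableOn ℂ g (ball c r)) (h : ∀ w, ¬ ball w K ⊆ g '' ball c r) :
    ‖deriv g c‖ * r ≤ 128 * K := by
  have hsub : closedBall c (r / 2) ⊆ ball c r := closedBall_subset_ball (by linarith)
  have hcont : ContinuousOn (fun z => ‖deriv g z‖ * (r / 2 - dist z c)) (closedBall c (r / 2)) := by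
    refine ContinuousOn.mul ?_ (by fun_prop)
    exact ((hg.deriv isOpen_ball).continuousOn.mono hsub).norm
  have hcm : c ∈ closedBall c (r / 2) := mem_closedBall_self (by positivity)
  -- Landau's device: maximizing |g'(z)| times the distance to the boundary gives a point p with
  -- |g'| ≤ 2|g'(p)| on the disc about p of half that distance.
  obtain ⟨p, hp, hmax⟩ := (isCompact_closedBall c (r / 2)).exists_isMaxOn ⟨c, hcm⟩ hcont
  have hcp := hmax hcm
  simp only [Set.mem_ofPred_eq, dist_self, sub_zero] at hcp
  by_contra! hlt
  have hpos : 0 < ‖deriv g p‖ * (r / 2 - dist p c) := by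
    nlinarith
  have htpos : 0 < r / 2 - dist p c := by
    by_contra! hle
    nlinarith [norm_nonneg (deriv g p)]
  set t := (r / 2 - dist p c) / 2 with ht
  have htp : 0 < t := by positivity
  have hsubt : ball p t ⊆ closedBall c (r / 2) := by
    intro z hz
    rw [mem_ball] at hz
    rw [mem_closedBall]
    linarith [dist_triangle z p c]
  have hb : ∀ z ∈ ball p t, ‖deriv g z‖ ≤ 2 * ‖deriv g p‖ := by
    intro z hz
    have h1 := hmax (hsubt hz)
    simp only [Set.mem_ofPred_eq] at h1
    have h2 : t ≤ r / 2 - dist z c := by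
      rw [mem_ball] at hz
      linarith [dist_triangle z p c]
    have h3 : ‖deriv g z‖ * t ≤ ‖deriv g p‖ * (2 * t) := by
      calc ‖deriv g z‖ * t ≤ ‖deriv g z‖ * (r / 2 - dist z c) := by gcongr
        _ ≤ _ := h1
        _ = _ := by rw [ht]; ring
    nlinarith
  have := ball_subset_image_of_norm_deriv_le htp (hg.mono (hsubt.trans hsub)) hb
  refine h (g p) ((ball_subset_ball ?_).trans (this.trans (Set.image_mono (hsubt.trans hsub))))
  have : t * ‖deriv g p‖ * 2 = ‖deriv g p‖ * (r / 2 - dist p c) := by rw [ht]; ring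
  linarith

/-- On the lines Re p = 2πm, cos p = cosh(Im p), and cosh grows by at least 1 over any interval of
length π in [0, ∞). A suitable point is thus within π of w in each coordinate, and 2π < 7. -/
theorem exists_cos_eq_intCast_near (w : ℂ) :
    ∃ p ∈ Metric.ball w 7, ∃ n : ℤ, Complex.cos p = n := by
  have key : ∀ v : ℝ, 0 ≤ v → ∃ y ∈ Set.Icc v (v + Real.pi), ∃ n : ℤ, Real.cosh y = n := by
    intro v hv
    have hs : Real.pi ≤ Real.sinh Real.pi := Real.self_le_sinh_iff.2 Real.pi_pos.le
    have h1 : Real.cosh v + 1 ≤ Real.cosh (v + Real.pi) := by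
      rw [Real.cosh_add]
      nlinarith [Real.one_le_cosh v, Real.sinh_lt_cosh Real.pi, Real.pi_gt_three,
        mul_nonneg (Real.sinh_nonneg_iff.2 hv) (Real.pi_pos.le.trans hs)]
    have hmem : ((⌈Real.cosh v⌉ : ℤ) : ℝ) ∈ Set.Icc (Real.cosh v) (Real.cosh (v + Real.pi)) :=
      ⟨Int.le_ceil _, by linarith [Int.ceil_lt_add_one (Real.cosh v)]⟩
    obtain ⟨y, hy, hye⟩ := intermediate_value_Icc (by linarith [Real.pi_pos] : v ≤ v + Real.pi)
      Real.continuous_cosh.continuousOn hmem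
    exact ⟨y, hy, _, hye⟩
  have key2 : ∃ y : ℝ, |y - w.im| ≤ Real.pi ∧ ∃ n : ℤ, Real.cosh y = n := by
    rcases le_total 0 w.im with h | h
    · obtain ⟨y, hy, n, hn⟩ := key _ h
      exact ⟨y, by rw [abs_le]; constructor <;> linarith [hy.1, hy.2, Real.pi_pos], n, hn⟩
    · obtain ⟨y, hy, n, hn⟩ := key (-w.im) (by linarith)
      exact ⟨-y, by rw [abs_le]; constructor <;> linarith [hy.1, hy.2, Real.pi_pos], n, by
        rw [Real.cosh_neg, hn]⟩
  obtain ⟨y, hy, n, hn⟩ := key2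
  set m : ℤ := round (w.re / (2 * Real.pi)) with hm
  refine ⟨y * Complex.I + m * (2 * Real.pi), ?_, n, ?_⟩
  · rw [Metric.mem_ball, dist_eq_norm]
    refine (Complex.norm_le_abs_re_add_abs_im _).trans_lt ?_
    have h1 : (↑y * Complex.I + ↑m * (2 * ↑Real.pi) - w).im = y - w.im := by simp
    have h2 : (↑y * Complex.I + ↑m * (2 * ↑Real.pi) - w).re =
        -((w.re / (2 * Real.pi) - m) * (2 * Real.pi)) := by
      have := Real.pi_ne_zero
      simp
      field_simp
      ring
    rw [h1, h2, abs_neg, abs_mul, abs_of_pos (by positivity : 0 < 2 * Real.pi)]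
    have := abs_sub_round (w.re / (2 * Real.pi))
    nlinarith [Real.pi_pos, Real.pi_lt_d2]
  · rw [Complex.cos_add_int_mul_two_pi, Complex.cos_mul_I, ← Complex.ofReal_cosh, hn]
    simp

open Metric in
/-- A holomorphic function on a disc whose image contains no disc of radius `K` is Lipschitz on
the concentric disc of half the radius. -/
theorem norm_sub_le_of_forall_not_ball_subset {g : ℂ → ℂ} {c : ℂ} {r K : ℝ} (hr : 0 < r)
    (hK : 0 ≤ K) (hg : DifferentiableOn ℂ g (ball c r)) (h : ∀ w, ¬ ball w K ⊆ g '' ball c r)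
    {z : ℂ} (hz : z ∈ closedBall c (r / 2)) : ‖g z - g c‖ ≤ 128 * K := by
  have hder : ∀ w ∈ closedBall c (r / 2), ‖deriv g w‖ ≤ 256 * K / r := by
    intro w hw
    have hsub : ball w (r / 2) ⊆ ball c r := by
      refine ball_subset_ball' ?_
      rw [mem_closedBall] at hw
      linarith
    have := norm_deriv_mul_le_of_forall_not_ball_subset (half_pos hr) hK (hg.mono hsub)
      (fun v hv => h v (hv.trans (Set.image_mono hsub)))
    rw [le_div_iff₀ hr]
    linarith
  have hsub : closedBall c (r / 2) ⊆ ball c r := closedBall_subset_ball (by linarith)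
  have h1 := (convex_closedBall c (r / 2)).norm_image_sub_le_of_norm_deriv_le
    (fun w hw => (hg w (hsub hw)).differentiableAt (isOpen_ball.mem_nhds (hsub hw)))
    hder (mem_closedBall_self (by positivity)) hz
  refine h1.trans ?_
  rw [mem_closedBall, dist_eq_norm] at hz
  calc 256 * K / r * ‖z - c‖ ≤ 256 * K / r * (r / 2) := by gcongr
    _ = 128 * K := by field_simp; ring

open Metric in
/-- **Schottky's theorem** for functions omitting `0` and `1`. -/
theorem exists_norm_le_of_omits_zero_one (C : ℝ) : ∃ C' : ℝ, ∀ (f : ℂ → ℂ) (c : ℂ) (r : ℝ), 0 < r →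
    DifferentiableOn ℂ f (ball c r) → (∀ z ∈ ball c r, f z ≠ 0) → (∀ z ∈ ball c r, f z ≠ 1) →
    ‖f c‖ ≤ C → ∀ z ∈ closedBall c (r / 2), ‖f z‖ ≤ C' := by
  -- Here 896 = 128 · 7 bounds the oscillation of the second cosine lift, whose image contains no
  -- disc of radius 7.
  refine ⟨Real.exp (Real.pi * Real.exp (2 * Real.pi + 2 * C + 1 + 896)) + 1,
    fun f c r hr hf h0 h1 hC z hz => ?_⟩
  have hzr : z ∈ ball c r := closedBall_subset_ball (by linarith) hz
  have hpi : (Real.pi : ℂ) ≠ 0 := by exact_mod_cast Real.pi_ne_zero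
  -- Two lifts: 2f - 1 = cos F, where F/π omits the integers because f omits 0 and 1; then F/π = cos
  -- G, so G omits every point at which cosine is an integer.
  obtain ⟨F, hF, hFe, hFc⟩ := exists_cos_eq_on_ball (f := fun z => 2 * f z - 1) hr
    ((hf.const_mul 2).sub_const 1) (fun z hz h => h1 z hz (by linear_combination h / 2))
    (fun z hz h => h0 z hz (by linear_combination h / 2))
  have hint : ∀ z ∈ ball c r, ∀ n : ℤ, F z / Real.pi ≠ n := by
    intro z hz n hn
    rw [div_eq_iff hpi] at hn
    have h2 := hFe z hz
    have h3 := Complex.sin_sq_add_cos_sq (F z)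
    rw [hn, Complex.sin_int_mul_pi, ← hn, h2] at h3
    have : f z * (f z - 1) = 0 := by linear_combination h3 / 4
    rcases mul_eq_zero.1 this with h | h
    · exact h0 z hz h
    · exact h1 z hz (sub_eq_zero.1 h)
  obtain ⟨G, hG, hGe, hGc⟩ := exists_cos_eq_on_ball (f := fun z => F z / Real.pi) hr
    (hF.div_const _) (fun z hz h => hint z hz 1 (by simpa using h))
    (fun z hz h => hint z hz (-1) (by simpa using h))
  have hno : ∀ w, ¬ ball w 7 ⊆ G '' ball c r := by
    intro w hw
    obtain ⟨p, hp, n, hn⟩ := exists_cos_eq_intCast_near w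
    obtain ⟨z, hz, rfl⟩ := hw hp
    exact hint z hz n (by rw [← hGe z hz, hn])
  have hGz := norm_sub_le_of_forall_not_ball_subset hr (by norm_num) hG hno hz
  have hdiv : ∀ w : ℂ, ‖w / Real.pi‖ = ‖w‖ / Real.pi := fun w => by
    rw [norm_div, Complex.norm_real, Real.norm_of_nonneg Real.pi_pos.le]
  have hFc' : ‖F c / Real.pi‖ ≤ Real.pi + 2 * C + 1 := by
    rw [hdiv]
    refine (div_le_self (norm_nonneg _) (by linarith [Real.pi_gt_three])).trans (hFc.trans ?_)
    have := norm_sub_le (2 * f c) 1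
    simp only [norm_mul, Complex.norm_two, norm_one] at this
    linarith
  have hGz' : ‖G z‖ ≤ 2 * Real.pi + 2 * C + 1 + 896 := by
    have := norm_sub_norm_le (G z) (G c)
    linarith
  have hFz : ‖F z‖ ≤ Real.pi * Real.exp (2 * Real.pi + 2 * C + 1 + 896) := by
    have h2 := norm_cos_le_exp_norm (G z)
    rw [hGe z hzr, hdiv, div_le_iff₀ Real.pi_pos, mul_comm] at h2
    exact h2.trans (by gcongr)
  have h2 := norm_cos_le_exp_norm (F z)
  rw [hFe z hzr] at h2
  have h3 := norm_sub_norm_le (2 * f z) 1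
  simp only [norm_mul, Complex.norm_two, norm_one] at h3
  have h4 := Real.exp_le_exp.2 hFz
  have h5 := norm_nonneg (f z)
  linarith

open Metric in
/-- **Schottky's theorem** for functions omitting two given values. -/
theorem exists_norm_le_of_omits {a b : ℂ} (hab : a ≠ b) (C : ℝ) : ∃ C' : ℝ,
    ∀ (f : ℂ → ℂ) (c : ℂ) (r : ℝ), 0 < r →
    DifferentiableOn ℂ f (ball c r) → (∀ z ∈ ball c r, f z ≠ a) → (∀ z ∈ ball c r, f z ≠ b) →
    ‖f c‖ ≤ C → ∀ z ∈ closedBall c (r / 2), ‖f z‖ ≤ C' := by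
  have hba : b - a ≠ 0 := sub_ne_zero.2 hab.symm
  have hn : 0 < ‖b - a‖ := norm_pos_iff.2 hba
  obtain ⟨D, hD⟩ := exists_norm_le_of_omits_zero_one ((C + ‖a‖) / ‖b - a‖)
  refine ⟨D * ‖b - a‖ + ‖a‖, fun f c r hr hf h0 h1 hC z hz => ?_⟩
  have := hD (fun z => (f z - a) / (b - a)) c r hr ((hf.sub_const a).div_const _)
    (fun z hz h => h0 z hz (by simpa [hba, sub_eq_zero] using h))
    (fun z hz h => h1 z hz (by
      rw [div_eq_one_iff_eq hba] at h
      linear_combination h))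
    (by
      rw [norm_div]
      gcongr
      linarith [norm_sub_le (f c) a]) z hz
  rw [norm_div, div_le_iff₀ hn] at this
  linarith [norm_sub_norm_le (f z) a]

open Metric in
/-- **Montel's theorem** for a bounded sequence of holomorphic functions on a disc. -/
theorem exists_subseq_tendstoUniformlyOn_of_norm_le {u : ℕ → ℂ → ℂ} {c : ℂ} {r C : ℝ} (hr : 0 < r)
    (hu : ∀ n, DifferentiableOn ℂ (u n) (ball c r)) (hC : ∀ n, ∀ z ∈ ball c r, ‖u n z‖ ≤ C) :
    ∃ ψ : ℕ → ℕ, StrictMono ψ ∧ ∃ g : ℂ → ℂ,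
      TendstoUniformlyOn (fun k => u (ψ k)) g atTop (closedBall c (r / 2)) := by
  have hC0 : 0 ≤ C := (norm_nonneg _).trans (hC 0 c (mem_ball_self hr))
  have hsub : closedBall c (r / 2) ⊆ ball c r := closedBall_subset_ball (by linarith)
  have hlip : ∀ n, LipschitzOnWith (Real.toNNReal (C / (r / 4))) (u n) (closedBall c (r / 2)) := by
    intro n
    refine (convex_closedBall c (r / 2)).lipschitzOnWith_of_nnnorm_deriv_le
      (fun w hw => (hu n w (hsub hw)).differentiableAt (isOpen_ball.mem_nhds (hsub hw))) ?_
    intro w hw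
    rw [← NNReal.coe_le_coe, coe_nnnorm, Real.coe_toNNReal _ (by positivity)]
    have hsub2 : closedBall w (r / 4) ⊆ ball c r := by
      refine closedBall_subset_ball' ?_
      rw [mem_closedBall] at hw
      linarith
    exact Complex.norm_deriv_le_of_forall_mem_sphere_norm_le (by positivity)
      (((hu n).mono hsub2).diffContOnCl_ball Set.Subset.rfl)
      (fun v hv => hC n v (hsub2 (sphere_subset_closedBall hv)))
  let X := closedBall c (r / 2)
  have : CompactSpace X := isCompact_iff_compactSpace.1 (isCompact_closedBall _ _)
  let U : ℕ → BoundedContinuousFunction X ℂ := fun n =>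
    BoundedContinuousFunction.mkOfCompact ⟨X.domRestrict (u n), (hlip n).continuousOn.domRestrict⟩
  have hcomp := BoundedContinuousFunction.arzela_ascoli (closedBall (0 : ℂ) C)
    (isCompact_closedBall _ _) (Set.range U) (by
      rintro _ x ⟨n, rfl⟩
      exact mem_closedBall_zero_iff.2 (hC n x (hsub x.2))) (by
      refine (LipschitzWith.uniformEquicontinuous _ (Real.toNNReal (C / (r / 4))) ?_).equicontinuous
      rintro ⟨_, n, rfl⟩
      exact (hlip n).to_restrict)
  obtain ⟨G, -, ψ, hψ, hG⟩ := hcomp.tendsto_subseq (fun n => subset_closure (Set.mem_range_self n))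
  classical
  refine ⟨ψ, hψ, fun z => if h : z ∈ X then G ⟨z, h⟩ else 0, ?_⟩
  rw [BoundedContinuousFunction.tendsto_iff_tendstoUniformly] at hG
  rw [tendstoUniformlyOn_iff_tendstoUniformly_comp_coe]
  have e : (fun z => if h : z ∈ X then G ⟨z, h⟩ else 0) ∘ ((↑) : X → ℂ) = G := by
    ext x
    simp
  rw [e]
  exact hG

open Metric in
/-- **Montel's theorem** for a sequence of holomorphic functions omitting two values. -/
theorem exists_subseq_of_omits {u : ℕ → ℂ → ℂ} {a b c : ℂ} {r : ℝ} (hab : a ≠ b) (hr : 0 < r)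
    (hu : ∀ n, DifferentiableOn ℂ (u n) (ball c r)) (ha : ∀ n, ∀ z ∈ ball c r, u n z ≠ a)
    (hb : ∀ n, ∀ z ∈ ball c r, u n z ≠ b) :
    ∃ ψ : ℕ → ℕ, StrictMono ψ ∧
      ((∃ g : ℂ → ℂ, TendstoLocallyUniformlyOn (fun k => u (ψ k)) g atTop (ball c (r / 4))) ∨
        TendstoInftyLocallyUniformlyOn (fun k => u (ψ k)) (ball c (r / 4))) := by
  by_cases hbd : ∃ C : ℝ, ∃ᶠ k in atTop, ‖u k c‖ ≤ C
  · obtain ⟨C, hC⟩ := hbd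
    obtain ⟨χ, hχ, hχC⟩ := extraction_of_frequently_atTop hC
    obtain ⟨C', hC'⟩ := exists_norm_le_of_omits hab C
    have hsub : ball c (r / 2) ⊆ ball c r := ball_subset_ball (by linarith)
    obtain ⟨ψ, hψ, g, hg⟩ := exists_subseq_tendstoUniformlyOn_of_norm_le (u := fun k => u (χ k))
      (half_pos hr) (fun n => (hu _).mono hsub) (fun n z hz =>
        hC' (u (χ n)) c r hr (hu _) (ha _) (hb _) (hχC n) z (ball_subset_closedBall hz))
    refine ⟨χ ∘ ψ, hχ.comp hψ, Or.inl ⟨g, ?_⟩⟩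
    have e : r / 2 / 2 = r / 4 := by ring
    rw [e] at hg
    exact (hg.mono ball_subset_closedBall).tendstoLocallyUniformlyOn
  · push Not at hbd
    refine ⟨id, strictMono_id, Or.inr fun K hK _ C => ?_⟩
    obtain ⟨C', hC'⟩ := exists_norm_le_of_omits hab C
    filter_upwards [hbd C'] with k hk z hz
    by_contra! hlt
    have hzc := hK hz
    rw [mem_ball] at hzc
    have hsub : ball z (r / 2) ⊆ ball c r := ball_subset_ball' (by linarith)
    -- Schottky is applied from z back to c: a bounded value at z would force a bounded value at c.
    refine hk.not_ge (hC' (u k) z (r / 2) (by positivity) ((hu k).mono hsub)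
      (fun w hw => ha k w (hsub hw)) (fun w hw => hb k w (hsub hw)) hlt.le c ?_)
    rw [mem_closedBall, dist_comm]
    linarith

/-! ### Growth of entire functions -/

/-- An entire function of polynomial growth is a polynomial. -/
theorem exists_polynomial_of_norm_le {f : ℂ → ℂ} (hf : Differentiable ℂ f) {C r₀ : ℝ} {n : ℕ}
    (h : ∀ z, r₀ ≤ ‖z‖ → ‖f z‖ ≤ C * ‖z‖ ^ n) : ∃ p : Polynomial ℂ, ∀ z, f z = p.eval z := by
  have hzero : ∀ k, n < k → iteratedDeriv k f 0 = 0 := by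
    intro k hk
    have hle : ∀ᶠ ρ : ℝ in atTop, ‖iteratedDeriv k f 0‖ ≤ k.factorial * C * ρ⁻¹ ^ (k - n) := by
      filter_upwards [eventually_ge_atTop r₀, eventually_gt_atTop 0] with ρ hρ hρ0
      have := Complex.norm_iteratedDeriv_le_of_forall_mem_sphere_norm_le k hρ0
        (hf.diffContOnCl (s := Metric.ball 0 ρ)) (C := C * ρ ^ n) (fun z hz => by
          have hz' : ‖z‖ = ρ := by simpa using hz
          simpa [hz'] using h z (hz' ▸ hρ))
      refine this.trans (le_of_eq ?_)
      obtain ⟨m, rfl⟩ := Nat.exists_eq_add_of_lt hk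
      have e : n + m + 1 - n = m + 1 := by omega
      rw [e, inv_pow]
      field_simp
      ring
    have hlim : Tendsto (fun ρ : ℝ => k.factorial * C * ρ⁻¹ ^ (k - n)) atTop (𝓝 0) := by
      have h1 := (tendsto_inv_atTop_zero (𝕜 := ℝ)).pow (k - n)
      rw [zero_pow (by omega)] at h1
      simpa using h1.const_mul (k.factorial * C)
    exact norm_le_zero_iff.1 (ge_of_tendsto hlim hle)
  refine ⟨∑ k ∈ Finset.range (n + 1),
    Polynomial.C ((k.factorial : ℂ)⁻¹ * iteratedDeriv k f 0) * Polynomial.X ^ k, fun z => ?_⟩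
  rw [← Complex.taylorSeries_eq_of_entire' 0 z hf, tsum_eq_sum (s := Finset.range (n + 1)),
    Polynomial.eval_finsetSum]
  · simp
  · intro k hk
    rw [hzero k (by simpa [Nat.lt_succ_iff] using hk)]
    simp

/-- An entire function tending to `∞` at `∞` is a polynomial. -/
theorem exists_polynomial_of_tendsto_cobounded {f : ℂ → ℂ} (hf : Differentiable ℂ f)
    (h : Tendsto f (Bornology.cobounded ℂ) (Bornology.cobounded ℂ)) :
    ∃ p : Polynomial ℂ, ∀ z, f z = p.eval z := by
  -- g(w) = 1/f(1/w) has a removable singularity at 0, and the finite order n of its zero there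
  -- gives |f(z)| ≤ const · |z|^n near ∞.
  let g : ℂ → ℂ := Function.update (fun w => (f w⁻¹)⁻¹) 0 0
  have hgne : ∀ w, w ≠ 0 → g w = (f w⁻¹)⁻¹ := fun w hw => by simp [g, hw]
  have hinv : Tendsto (fun w : ℂ => f w⁻¹) (𝓝[≠] 0) (Bornology.cobounded ℂ) :=
    h.comp tendsto_inv₀_nhdsNE_zero
  have hcont : ContinuousAt g 0 := by
    rw [continuousAt_update_same]
    exact tendsto_inv₀_cobounded.comp hinv
  have hne : ∀ᶠ w in 𝓝[≠] (0 : ℂ), f w⁻¹ ≠ 0 :=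
    hinv.eventually (Bornology.eventually_ne_cobounded 0)
  have hdiff : ∀ᶠ w in 𝓝[≠] (0 : ℂ), DifferentiableAt ℂ g w := by
    filter_upwards [hne, self_mem_nhdsWithin] with w hw hw0
    have : DifferentiableAt ℂ (fun w => (f w⁻¹)⁻¹) w :=
      ((hf _).comp w (differentiableAt_inv hw0)).inv hw
    refine this.congr_of_eventuallyEq ?_
    filter_upwards [isOpen_ne.mem_nhds hw0] with v hv using hgne v hv
  have han : AnalyticAt ℂ g 0 :=
    Complex.analyticAt_of_differentiable_on_punctured_nhds_of_continuousAt hdiff hcont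
  have hnz : ¬ ∀ᶠ w in 𝓝 (0 : ℂ), g w = 0 := by
    intro hev
    obtain ⟨w, ⟨hw1, hw2⟩, hw3⟩ :=
      (((hev.filter_mono nhdsWithin_le_nhds).and hne).and self_mem_nhdsWithin).exists
    rw [hgne w hw3] at hw1
    exact hw2 (inv_eq_zero.1 hw1)
  obtain ⟨n, k, hk, hk0, hke⟩ := han.exists_eventuallyEq_pow_smul_nonzero_iff.2 hnz
  have hkb : ∀ᶠ w in 𝓝 (0 : ℂ), ‖k 0‖ / 2 < ‖k w‖ :=
    hk.continuousAt.norm.eventually (lt_mem_nhds (half_lt_self (norm_pos_iff.2 hk0)))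
  have hev : ∀ᶠ w in 𝓝[≠] (0 : ℂ), ‖f w⁻¹‖ ≤ (2 / ‖k 0‖) * ‖w⁻¹‖ ^ n := by
    filter_upwards [nhdsWithin_le_nhds hkb, nhdsWithin_le_nhds hke, self_mem_nhdsWithin]
      with w h1 h2 h3
    rw [hgne w h3] at h2
    have h4 : f w⁻¹ = w⁻¹ ^ n * (k w)⁻¹ := by
      rw [← inv_inv (f w⁻¹), h2]; simp [mul_comm]
    rw [h4, norm_mul, norm_pow, mul_comm, norm_inv (k w)]
    have h5 : 0 < ‖k 0‖ := norm_pos_iff.2 hk0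
    gcongr
    rw [← inv_div]
    gcongr
  have hev2 : ∀ᶠ z in Bornology.cobounded ℂ, ‖f z‖ ≤ (2 / ‖k 0‖) * ‖z‖ ^ n := by
    have := tendsto_inv₀_cobounded'.eventually hev
    simpa using this
  obtain ⟨ρ, -, hρ⟩ := (hasBasis_cobounded_norm (E := ℂ)).eventually_iff.1 hev2
  exact exists_polynomial_of_norm_le hf (r₀ := ρ) (fun z hz => hρ hz)

/-! ### Frontiers, images and trapped orbits -/

theorem subset_of_disjoint_frontier {X : Type*} [TopologicalSpace X] {S G : Set X}
    (hS : IsPreconnected S) (hG : IsOpen G) (hne : (S ∩ G).Nonempty)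
    (hd : Disjoint S (frontier G)) : S ⊆ G := by
  refine IsPreconnected.subset_left_of_subset_union hG isClosed_closure.isOpen_compl
    (Set.disjoint_compl_right_iff_subset.2 subset_closure) (fun x hx => ?_) hne hS
  by_cases h : x ∈ G
  · exact Or.inl h
  · refine Or.inr fun hc => Set.disjoint_left.1 hd hx ?_
    rw [hG.frontier_eq]
    exact ⟨hc, h⟩

theorem frontier_connectedComponentIn_subset {X : Type*} [TopologicalSpace X]
    [LocallyConnectedSpace X] {U : Set X} (hU : IsOpen U) (x : X) :
    frontier (connectedComponentIn U x) ⊆ Uᶜ := by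
  intro y hy hyU
  rw [hU.connectedComponentIn.frontier_eq] at hy
  obtain ⟨w, hw1, hw2⟩ := mem_closure_iff.1 hy.1 _ hU.connectedComponentIn
    (mem_connectedComponentIn hyU)
  apply hy.2
  rw [connectedComponentIn_eq hw2, ← connectedComponentIn_eq hw1]
  exact mem_connectedComponentIn hyU

theorem closure_image_subset_image_closure {F : ℂ → ℂ} (hF : Continuous F) {G : Set ℂ}
    (hG : Bornology.IsBounded G) : closure (F '' G) ⊆ F '' closure G :=
  closure_minimal (Set.image_mono subset_closure) (hG.isCompact_closure.image hF).isClosed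

theorem frontier_image_subset_image_frontier {F : ℂ → ℂ} (hF : Continuous F) (hFo : IsOpenMap F)
    {G : Set ℂ} (hGo : IsOpen G) (hG : Bornology.IsBounded G) :
    frontier (F '' G) ⊆ F '' frontier G := by
  intro y hy
  rw [(hFo G hGo).frontier_eq] at hy
  obtain ⟨x, hx, rfl⟩ := closure_image_subset_image_closure hF hG hy.1
  refine ⟨x, ?_, rfl⟩
  rw [hGo.frontier_eq]
  exact ⟨hx, fun h => hy.2 ⟨x, h, rfl⟩⟩

/-- Pulling back through K ⊆ g(K) produces orbit segments in K of every length; compactness of the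
nested sets of starting points gives an infinite one. -/
theorem exists_forall_iterate_mem {X : Type*} [TopologicalSpace X] [T2Space X] {g : X → X}
    {K : Set X} (hK : IsCompact K) (hne : K.Nonempty) (hg : Continuous g) (h : K ⊆ g '' K) :
    ∃ x, ∀ n, g^[n] x ∈ K := by
  have hex : ∀ n, ∀ y ∈ K, ∃ x, g^[n] x = y ∧ ∀ i ≤ n, g^[i] x ∈ K := by
    intro n
    induction n with
    | zero => exact fun y hy => ⟨y, rfl, fun i hi => by simpa [Nat.le_zero.1 hi] using hy⟩
    | succ n ih =>
      intro y hy
      obtain ⟨v, hv, rfl⟩ := h hy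
      obtain ⟨x, rfl, hx⟩ := ih v hv
      refine ⟨x, Function.iterate_succ_apply' g n x, fun i hi => ?_⟩
      rcases hi.eq_or_lt with rfl | hi
      · rwa [Function.iterate_succ_apply']
      · exact hx i (Nat.lt_succ_iff.1 hi)
  have hcl : ∀ n, IsClosed {x | ∀ i ≤ n, g^[i] x ∈ K} := by
    intro n
    simp only [Set.ofPred_forall]
    exact isClosed_iInter fun i => isClosed_iInter fun _ => hK.isClosed.preimage (hg.iterate i)
  obtain ⟨x, hx⟩ := IsCompact.nonempty_iInter_of_sequence_nonempty_isCompact_isClosed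
    (fun n => {x | ∀ i ≤ n, g^[i] x ∈ K}) (fun n x hx i hi => hx i (hi.trans n.le_succ))
    (fun n => by
      obtain ⟨y, hy⟩ := hne
      obtain ⟨x, -, hx⟩ := hex n y hy
      exact ⟨x, hx⟩)
    (hK.of_isClosed_subset (hcl 0) fun x hx => hx 0 le_rfl) hcl
  exact ⟨x, fun n => Set.mem_iInter.1 hx n n le_rfl⟩

/-! ### The maximum modulus and its iterates -/

theorem isClosed_levelSet {f : ℂ → ℂ} (hf : Continuous f) (r : ℝ) : IsClosed (levelSet f r) := by
  simp only [levelSet, Set.ofPred_forall]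
  exact isClosed_iInter fun n => isClosed_le continuous_const (hf.iterate n).norm

theorem norm_le_maxModulus {f : ℂ → ℂ} (hf : Differentiable ℂ f) {r : ℝ} (hr : 0 < r) {z : ℂ}
    (hz : ‖z‖ ≤ r) : ‖f z‖ ≤ maxModulus f r := by
  refine Complex.norm_le_of_forall_mem_frontier_norm_le (U := Metric.ball 0 r)
    Metric.isBounded_ball hf.diffContOnCl (fun w hw => ?_) ?_
  · rw [frontier_ball _ hr.ne'] at hw
    exact le_csSup ((isCompact_sphere 0 r).image hf.continuous.norm).bddAbove ⟨w, hw, rfl⟩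
  · rw [closure_ball _ hr.ne']
    simpa using hz

theorem exists_norm_eq_maxModulus {f : ℂ → ℂ} (hf : Differentiable ℂ f) {r : ℝ} (hr : 0 < r) :
    ∃ z, ‖z‖ = r ∧ ‖f z‖ = maxModulus f r := by
  obtain ⟨z, hz, h⟩ := ((isCompact_sphere (0 : ℂ) r).image hf.continuous.norm).sSup_mem
    ((NormedSpace.sphere_nonempty.2 hr.le).image _)
  exact ⟨z, by simpa using hz, h⟩

theorem IsTranscendentalEntire.isOpenMap {f : ℂ → ℂ} (hf : IsTranscendentalEntire f) :
    IsOpenMap f := by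
  refine (AnalyticOnNhd.is_constant_or_isOpenMap (fun z _ => hf.1.analyticAt z)).resolve_left ?_
  rintro ⟨w, hw⟩
  exact hf.2 ⟨Polynomial.C w, fun z => by simp [hw z]⟩

theorem norm_lt_maxModulus {f : ℂ → ℂ} (hf : IsTranscendentalEntire f) {r : ℝ} (hr : 0 < r)
    {z : ℂ} (hz : ‖z‖ < r) : ‖f z‖ < maxModulus f r := by
  have h1 : f '' Metric.ball 0 r ⊆ Metric.closedBall 0 (maxModulus f r) := by
    rintro _ ⟨w, hw, rfl⟩
    simpa using norm_le_maxModulus hf.1 hr (mem_ball_zero_iff.1 hw).le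
  have h2 := (hf.isOpenMap _ Metric.isOpen_ball).subset_interior_iff.2 h1
  rw [interior_closedBall'] at h2
  simpa using h2 ⟨z, mem_ball_zero_iff.2 hz, rfl⟩

/-- The iterated maximum modulus `M^n(R, f)`. -/
noncomputable abbrev maxModulusIter (f : ℂ → ℂ) (R : ℝ) (n : ℕ) : ℝ := (maxModulus f)^[n] R

/-- The fundamental hole: the component of the complement of `A_{M^n(R)}(f)` containing `0`. -/
def fundamentalHole (f : ℂ → ℂ) (R : ℝ) (n : ℕ) : Set ℂ :=
  connectedComponentIn (levelSet f (maxModulusIter f R n))ᶜ 0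

theorem mem_levelSet_maxModulusIter {f : ℂ → ℂ} {R : ℝ} {n : ℕ} {z : ℂ} :
    z ∈ levelSet f (maxModulusIter f R n) ↔ ∀ k, maxModulusIter f R (k + n) ≤ ‖f^[k] z‖ := by
  simp only [levelSet, maxModulusIter, Set.mem_ofPred_eq, Function.iterate_add_apply]

section Growth

variable {f : ℂ → ℂ} {R : ℝ}

theorem le_maxModulusIter (hM : ∀ r : ℝ, R ≤ r → r < maxModulus f r) (n : ℕ) :
    R ≤ maxModulusIter f R n := by
  induction n with
  | zero => exact le_rfl
  | succ n ih =>
    rw [maxModulusIter, Function.iterate_succ_apply']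
    exact ih.trans (hM _ ih).le

theorem strictMono_maxModulusIter (hM : ∀ r : ℝ, R ≤ r → r < maxModulus f r) :
    StrictMono (maxModulusIter f R) := by
  refine strictMono_nat_of_lt_succ fun n => ?_
  rw [maxModulusIter, maxModulusIter, Function.iterate_succ_apply']
  exact hM _ (le_maxModulusIter hM n)

/-- At a finite limit l one would have M(l) > l. Scaling a point where M(l) is attained down to
modulus M^n(R) keeps |f| > l for some n, so M^{n+1}(R) > l, which is absurd. -/
theorem tendsto_maxModulusIter (hf : Differentiable ℂ f) (hR : 0 < R)
    (hM : ∀ r : ℝ, R ≤ r → r < maxModulus f r) : Tendsto (maxModulusIter f R) atTop atTop := by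
  rcases tendsto_atTop_of_monotone (strictMono_maxModulusIter hM).monotone with h | ⟨l, hl⟩
  · exact h
  exfalso
  have hlt : ∀ n, maxModulusIter f R n < l := fun n =>
    ((strictMono_maxModulusIter hM) n.lt_succ_self).trans_le
      ((strictMono_maxModulusIter hM).monotone.ge_of_tendsto hl _)
  have hRl : R < l := hlt 0
  obtain ⟨z, hz, hfz⟩ := exists_norm_eq_maxModulus hf (hR.trans hRl)
  have hzl : l < ‖f z‖ := hfz ▸ hM l hRl.le
  have hcont : Tendsto (fun n => ‖f ((maxModulusIter f R n / l : ℝ) * z)‖) atTop (𝓝 ‖f z‖) := by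
    have h1 : Tendsto (fun n => ((maxModulusIter f R n / l : ℝ) : ℂ) * z) atTop (𝓝 z) := by
      have := ((Complex.continuous_ofReal.tendsto _).comp (hl.div_const l)).mul_const z
      rwa [div_self (hR.trans hRl).ne', Complex.ofReal_one, one_mul] at this
    exact (hf.continuous.norm.tendsto z).comp h1
  obtain ⟨n, hn⟩ := (hcont.eventually (lt_mem_nhds hzl)).exists
  have hpos : 0 < maxModulusIter f R n := hR.trans_le (le_maxModulusIter hM n)
  have h2 : ‖f ((maxModulusIter f R n / l : ℝ) * z)‖ ≤ maxModulusIter f R (n + 1) := by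
    rw [show maxModulusIter f R (n + 1) = maxModulus f (maxModulusIter f R n) from
      Function.iterate_succ_apply' _ _ _]
    refine norm_le_maxModulus hf hpos (le_of_eq ?_)
    have hl0 := hR.trans hRl
    rw [norm_mul, Complex.norm_real, hz, Real.norm_of_nonneg (by positivity)]
    field_simp
  linarith [hlt (n + 1)]

end Growth

/-! ### Fundamental holes and their dynamics -/

section Holes

variable {f : ℂ → ℂ} {R : ℝ} (hf : IsTranscendentalEntire f) (hR : 0 < R)
  (hM : ∀ r : ℝ, R ≤ r → r < maxModulus f r)

include hM in
theorem levelSet_maxModulusIter_antitone {m n : ℕ} (hmn : m ≤ n) :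
    levelSet f (maxModulusIter f R n) ⊆ levelSet f (maxModulusIter f R m) := fun z hz => by
  rw [mem_levelSet_maxModulusIter] at hz ⊢
  exact fun k => ((strictMono_maxModulusIter hM).monotone (by omega)).trans (hz k)

-- The defining inequalities agree up to an index shift, except for |z| ≥ M^n(R), which the strict
-- maximum principle recovers from |f(z)| ≥ M^{n+1}(R).
include hf hR hM in
theorem apply_mem_levelSet_iff {n : ℕ} {z : ℂ} :
    f z ∈ levelSet f (maxModulusIter f R (n + 1)) ↔ z ∈ levelSet f (maxModulusIter f R n) := by
  simp only [mem_levelSet_maxModulusIter]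
  constructor
  · rintro h (_ | k)
    · by_contra! hlt
      rw [zero_add, Function.iterate_zero, id] at hlt
      have h1 := norm_lt_maxModulus hf (hR.trans_le (le_maxModulusIter hM n)) hlt
      have h2 := h 0
      rw [zero_add, maxModulusIter, Function.iterate_succ_apply'] at h2
      exact h1.not_ge h2
    · have := h k
      rw [Function.iterate_succ_apply]
      rwa [show k + 1 + n = k + (n + 1) by omega]
  · intro h k
    have := h (k + 1)
    rwa [Function.iterate_succ_apply, show k + 1 + n = k + (n + 1) by omega] at this

theorem fundamentalHole_subset_compl (n : ℕ) :
    fundamentalHole f R n ⊆ (levelSet f (maxModulusIter f R n))ᶜ :=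
  connectedComponentIn_subset _ _

include hf in
theorem isOpen_fundamentalHole (n : ℕ) : IsOpen (fundamentalHole f R n) :=
  (isClosed_levelSet hf.1.continuous _).isOpen_compl.connectedComponentIn

include hf in
theorem frontier_fundamentalHole_subset (n : ℕ) :
    frontier (fundamentalHole f R n) ⊆ levelSet f (maxModulusIter f R n) := by
  have := frontier_connectedComponentIn_subset
    (isClosed_levelSet hf.1.continuous (maxModulusIter f R n)).isOpen_compl 0
  rwa [compl_compl] at this

include hR hM in
theorem ball_subset_fundamentalHole (n : ℕ) :
    Metric.ball 0 (maxModulusIter f R n) ⊆ fundamentalHole f R n := by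
  refine (convex_ball _ _).isPreconnected.subset_connectedComponentIn
    (Metric.mem_ball_self (hR.trans_le (le_maxModulusIter hM n))) fun z hz h => ?_
  have := mem_levelSet_maxModulusIter.1 h 0
  rw [zero_add] at this
  exact (mem_ball_zero_iff.1 hz).not_ge this

include hR hM in
theorem zero_mem_fundamentalHole (n : ℕ) : (0 : ℂ) ∈ fundamentalHole f R n :=
  ball_subset_fundamentalHole hR hM n
    (Metric.mem_ball_self (hR.trans_le (le_maxModulusIter hM n)))

include hM in
theorem fundamentalHole_mono {m n : ℕ} (hmn : m ≤ n) :
    fundamentalHole f R m ⊆ fundamentalHole f R n :=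
  connectedComponentIn_mono _ (Set.compl_subset_compl.2 (levelSet_maxModulusIter_antitone hM hmn))

include hf hR hM in
theorem exists_subset_fundamentalHole {S : Set ℂ} (hS : Bornology.IsBounded S) (p : ℕ) :
    ∃ n, p ≤ n ∧ S ⊆ fundamentalHole f R n := by
  obtain ⟨C, hC⟩ := hS.subset_ball 0
  obtain ⟨n, hn, hpn⟩ := (((tendsto_maxModulusIter hf.1 hR hM).eventually_ge_atTop C).and
    (eventually_ge_atTop p)).exists
  exact ⟨n, hpn, hC.trans ((Metric.ball_subset_ball hn).trans (ball_subset_fundamentalHole hR hM n))⟩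

-- The image is connected, contains f(0) and avoids the next level set, giving one inclusion. For
-- the other, the frontier of the image lies in the image of the frontier, hence in that level set,
-- which the next hole avoids.
include hf hR hM in
theorem image_fundamentalHole_of_isBounded {n : ℕ} (hb : Bornology.IsBounded (fundamentalHole f R n)) :
    f '' fundamentalHole f R n = fundamentalHole f R (n + 1) := by
  have hf0 : f 0 ∈ fundamentalHole f R (n + 1) := by
    apply ball_subset_fundamentalHole hR hM
    rw [mem_ball_zero_iff, maxModulusIter, Function.iterate_succ_apply']
    have hpos := hR.trans_le (le_maxModulusIter hM n)
    exact norm_lt_maxModulus hf hpos (by simpa using hpos)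
  have h0 := zero_mem_fundamentalHole hR hM n
  apply Set.Subset.antisymm
  · have hpre : IsPreconnected (f '' fundamentalHole f R n) :=
      isPreconnected_connectedComponentIn.image f hf.1.continuous.continuousOn
    have := hpre.subset_connectedComponentIn (x := f 0)
      (F := (levelSet f (maxModulusIter f R (n + 1)))ᶜ) ⟨0, h0, rfl⟩ (by
        rintro _ ⟨z, hz, rfl⟩ h
        exact fundamentalHole_subset_compl n hz ((apply_mem_levelSet_iff hf hR hM).1 h))
    rwa [← connectedComponentIn_eq hf0] at this
  · refine subset_of_disjoint_frontier isPreconnected_connectedComponentIn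
      (hf.isOpenMap _ (isOpen_fundamentalHole hf n)) ⟨f 0, hf0, 0, h0, rfl⟩ ?_
    rw [Set.disjoint_left]
    intro y hy hyf
    obtain ⟨x, hx, rfl⟩ := frontier_image_subset_image_frontier hf.1.continuous hf.isOpenMap
      (isOpen_fundamentalHole hf n) hb hyf
    exact fundamentalHole_subset_compl (n + 1) hy
      ((apply_mem_levelSet_iff hf hR hM).2 (frontier_fundamentalHole_subset hf n hx))

variable (hweb : IsSpidersWeb (levelSet f R))

include hf hR hM hweb in
theorem isBounded_fundamentalHole (n : ℕ) : Bornology.IsBounded (fundamentalHole f R n) := by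
  induction n with
  | zero =>
    obtain ⟨-, G, hG, -, hfr, hU⟩ := hweb
    obtain ⟨k, hk⟩ := Set.mem_iUnion.1 (hU ▸ Set.mem_univ (0 : ℂ))
    refine (hG k).2.1.subset (subset_of_disjoint_frontier isPreconnected_connectedComponentIn
      (hG k).1 ⟨0, zero_mem_fundamentalHole hR hM 0, hk⟩ ?_)
    rw [Set.disjoint_left]
    exact fun z hz hzf => fundamentalHole_subset_compl 0 hz (hfr k hzf)
  | succ n ih =>
    rw [← image_fundamentalHole_of_isBounded hf hR hM ih]
    exact (ih.isCompact_closure.image hf.1.continuous).isBounded.subset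
      (Set.image_mono subset_closure)

include hf hR hM hweb in
theorem image_fundamentalHole (n : ℕ) : f '' fundamentalHole f R n = fundamentalHole f R (n + 1) :=
  image_fundamentalHole_of_isBounded hf hR hM (isBounded_fundamentalHole hf hR hM hweb n)

include hf hR hM hweb in
theorem iterate_image_fundamentalHole (k n : ℕ) :
    f^[k] '' fundamentalHole f R n = fundamentalHole f R (n + k) := by
  induction k with
  | zero => simp
  | succ k ih =>
    rw [Function.iterate_succ', Set.image_comp, ih, image_fundamentalHole hf hR hM hweb]
    rfl

-- Boundedness supplies m for n = 0; applying f repeatedly carries the same m to every n. This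
-- uniformity lets closures be taken at the cost of a fixed index shift.
include hf hR hM hweb in
theorem exists_closure_fundamentalHole_subset :
    ∃ m, 0 < m ∧ ∀ n, closure (fundamentalHole f R n) ⊆ fundamentalHole f R (n + m) := by
  obtain ⟨m, hm, hsub⟩ := exists_subset_fundamentalHole hf hR hM
    (isBounded_fundamentalHole hf hR hM hweb 0).closure 1
  refine ⟨m, hm, fun n => ?_⟩
  induction n with
  | zero => simpa using hsub
  | succ n ih =>
    rw [← image_fundamentalHole hf hR hM hweb, show n + 1 + m = n + m + 1 by omega,
      ← image_fundamentalHole hf hR hM hweb]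
    exact (closure_image_subset_image_closure hf.1.continuous
      (isBounded_fundamentalHole hf hR hM hweb n)).trans (Set.image_mono ih)

-- Holes may replace discs in the definition: H_n contains the disc of radius M^n(R), and a fast
-- escaping orbit lies in A_{M^n(R)}(f), outside H_n, at time n + L.
include hR hM in
theorem mem_fastEscapingSet_iff {z : ℂ} :
    z ∈ fastEscapingSet f R ↔ ∃ L : ℕ, ∀ n : ℕ, f^[n + L] z ∉ fundamentalHole f R n := by
  refine exists_congr fun L => ⟨fun h n hn => ?_, fun h n => ?_⟩
  · refine fundamentalHole_subset_compl n hn (mem_levelSet_maxModulusIter.2 fun k => ?_)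
    rw [← Function.iterate_add_apply, ← add_assoc]
    exact h (k + n)
  · by_contra! hlt
    exact h n (ball_subset_fundamentalHole hR hM n (mem_ball_zero_iff.2 hlt))

include hM in
theorem apply_mem_fastEscapingSet_iff {z : ℂ} :
    f z ∈ fastEscapingSet f R ↔ z ∈ fastEscapingSet f R := by
  constructor
  · rintro ⟨L, h⟩
    exact ⟨L + 1, fun n => h n⟩
  · rintro ⟨L, h⟩
    refine ⟨L, fun n => ((strictMono_maxModulusIter hM).monotone n.le_succ).trans ?_⟩
    have := h (n + 1)
    rwa [show n + 1 + L = n + L + 1 by omega, Function.iterate_succ_apply] at this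

include hM in
theorem iterate_mem_fastEscapingSet_iff {z : ℂ} (k : ℕ) :
    f^[k] z ∈ fastEscapingSet f R ↔ z ∈ fastEscapingSet f R := by
  induction k with
  | zero => rfl
  | succ k ih => rw [Function.iterate_succ_apply', apply_mem_fastEscapingSet_iff hM, ih]

include hM in
theorem levelSet_subset_fastEscapingSet (n : ℕ) :
    levelSet f (maxModulusIter f R n) ⊆ fastEscapingSet f R := fun _ hz =>
  ⟨0, fun k => mem_levelSet_maxModulusIter.1 (levelSet_maxModulusIter_antitone hM n.zero_le hz) k⟩

include hf hM in
theorem subset_fundamentalHole_of_isPreconnected {S : Set ℂ} (hS : IsPreconnected S)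
    (hSA : S ⊆ (fastEscapingSet f R)ᶜ) {n : ℕ} (hne : (S ∩ fundamentalHole f R n).Nonempty) :
    S ⊆ fundamentalHole f R n := by
  refine subset_of_disjoint_frontier hS (isOpen_fundamentalHole hf n) hne ?_
  rw [Set.disjoint_left]
  exact fun z hz hzf => hSA hz (levelSet_subset_fastEscapingSet hM n
    (frontier_fundamentalHole_subset hf n hzf))

/-! ### Components of the complement of A(f) -/

include hM in
theorem iterate_image_connectedComponentIn_subset (hfc : Continuous f) {z : ℂ}
    (hz : z ∈ (fastEscapingSet f R)ᶜ) (k : ℕ) :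
    f^[k] '' connectedComponentIn (fastEscapingSet f R)ᶜ z ⊆
      connectedComponentIn (fastEscapingSet f R)ᶜ (f^[k] z) := by
  refine (isPreconnected_connectedComponentIn.image _
    (hfc.iterate k).continuousOn).subset_connectedComponentIn
    ⟨z, mem_connectedComponentIn hz, rfl⟩ ?_
  rintro _ ⟨w, hw, rfl⟩
  rw [Set.mem_compl_iff, iterate_mem_fastEscapingSet_iff hM]
  exact connectedComponentIn_subset _ _ hw

include hf hR hM hweb in
theorem isCompact_connectedComponentIn_compl_fastEscapingSet {z : ℂ}
    (hz : z ∈ (fastEscapingSet f R)ᶜ) :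
    IsCompact (connectedComponentIn (fastEscapingSet f R)ᶜ z) := by
  set K := connectedComponentIn (fastEscapingSet f R)ᶜ z with hK
  have hpre : IsPreconnected K := isPreconnected_connectedComponentIn
  have hzK : z ∈ K := mem_connectedComponentIn hz
  have hKA : K ⊆ (fastEscapingSet f R)ᶜ := connectedComponentIn_subset _ _
  obtain ⟨m, -, hm⟩ := exists_closure_fundamentalHole_subset hf hR hM hweb
  have hcl : closure K ⊆ (fastEscapingSet f R)ᶜ := by
    intro w hw hwA
    obtain ⟨L, hL⟩ := (mem_fastEscapingSet_iff hR hM).1 hwA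
    -- If z entered H_n at time n + m + L, all of K would, and its limit point w would lie in
    -- H_{n+m} at that time, contrary to the choice of L.
    refine hz ((mem_fastEscapingSet_iff hR hM).2 ⟨m + L, fun n hn => hL (n + m) ?_⟩)
    rw [← add_assoc] at hn
    have hcont := hf.1.continuous.iterate (n + m + L)
    have hsub : f^[n + m + L] '' K ⊆ fundamentalHole f R n := by
      refine subset_fundamentalHole_of_isPreconnected hf hM (hpre.image _ hcont.continuousOn) ?_
        ⟨_, ⟨z, hzK, rfl⟩, hn⟩
      rintro _ ⟨v, hv, rfl⟩
      rw [Set.mem_compl_iff, iterate_mem_fastEscapingSet_iff hM]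
      exact hKA hv
    exact hm n (closure_mono hsub (image_closure_subset_closure_image hcont ⟨w, hw, rfl⟩))
  have hclosed : IsClosed K := isClosed_of_closure_subset
    (hpre.closure.subset_connectedComponentIn (subset_closure hzK) hcl)
  obtain ⟨n, -, hn⟩ := exists_subset_fundamentalHole hf hR hM
    (Bornology.isBounded_singleton (x := z)) 0
  exact Metric.isCompact_of_isClosed_isBounded hclosed
    ((isBounded_fundamentalHole hf hR hM hweb n).subset
      (subset_fundamentalHole_of_isPreconnected hf hM hpre hKA ⟨z, hzK, hn rfl⟩))

-- Since the closure of H_0 lies in H_m = f^m(H_0), some orbit under f^m stays in that closure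
-- forever; such a point cannot escape fast.
include hf hR hM hweb in
theorem nonempty_compl_fastEscapingSet : (fastEscapingSet f R)ᶜ.Nonempty := by
  obtain ⟨m, hm0, hm⟩ := exists_closure_fundamentalHole_subset hf hR hM hweb
  have hsub := hm 0
  rw [← iterate_image_fundamentalHole hf hR hM hweb] at hsub
  obtain ⟨c, hc⟩ := exists_forall_iterate_mem
    (isBounded_fundamentalHole hf hR hM hweb 0).isCompact_closure
    ⟨0, subset_closure (zero_mem_fundamentalHole hR hM 0)⟩ (hf.1.continuous.iterate m)
    (hsub.trans (Set.image_mono subset_closure))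
  refine ⟨c, fun hcA => ?_⟩
  obtain ⟨L, hL⟩ := (mem_fastEscapingSet_iff hR hM).1 hcA
  have hle : m + L ≤ m * (L + 1) := by nlinarith
  -- This index is at least m, so the point of the f^m-orbit, lying in H_m, also lies in the hole of
  -- this index.
  apply hL (m * (L + 1) - L)
  rw [Nat.sub_add_cancel (by omega), Function.iterate_mul]
  have := hm 0 (hc (L + 1))
  exact fundamentalHole_mono hM (by omega) this

-- Suppose A(f)^c lies in H_p. A transcendental f takes bounded values at points arbitrarily far
-- out, so the image of some H_{p'} minus the closure of H_p meets H_{p+1} and, by the frontier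
-- argument, covers it. A point of A(f)^c then has a preimage outside H_p, and that preimage is also
-- in A(f)^c.
include hf hR hM hweb in
theorem not_isBounded_compl_fastEscapingSet :
    ¬ Bornology.IsBounded (fastEscapingSet f R)ᶜ := by
  intro hb
  obtain ⟨c, hc⟩ := nonempty_compl_fastEscapingSet hf hR hM hweb
  have hnt : ¬ Tendsto f (Bornology.cobounded ℂ) (Bornology.cobounded ℂ) := fun h =>
    hf.2 (exists_polynomial_of_tendsto_cobounded hf.1 h)
  rw [← tendsto_norm_atTop_iff_cobounded, tendsto_atTop] at hnt
  push Not at hnt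
  obtain ⟨C, hC⟩ := hnt
  obtain ⟨q, -, hq⟩ := exists_subset_fundamentalHole hf hR hM
    (Metric.isBounded_ball (x := (0 : ℂ)) (r := C)) 0
  obtain ⟨p, hqp, hp⟩ := exists_subset_fundamentalHole hf hR hM hb q
  have hbp := isBounded_fundamentalHole hf hR hM hweb p
  have hev : ∀ᶠ z in Bornology.cobounded ℂ, z ∉ closure (fundamentalHole f R p) :=
    Bornology.isBounded_def.1 hbp.closure
  obtain ⟨z, hz1, hz2⟩ := (hC.and_eventually hev).exists
  obtain ⟨p', hpp', hzp'⟩ := exists_subset_fundamentalHole hf hR hM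
    (Bornology.isBounded_singleton (x := z)) p
  set A := fundamentalHole f R p' ∩ (closure (fundamentalHole f R p))ᶜ with hA
  have hAo : IsOpen A := (isOpen_fundamentalHole hf p').inter isClosed_closure.isOpen_compl
  have hAb : Bornology.IsBounded A :=
    (isBounded_fundamentalHole hf hR hM hweb p').subset Set.inter_subset_left
  have hfrA : frontier A ⊆ levelSet f (maxModulusIter f R p) := by
    intro x hx
    rcases frontier_inter_subset _ _ hx with h | h
    · exact levelSet_maxModulusIter_antitone hM hpp' (frontier_fundamentalHole_subset hf p' h.1)
    · have := h.2
      rw [frontier_compl] at this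
      exact frontier_fundamentalHole_subset hf p (frontier_closure_subset this)
  have hfz : f z ∈ fundamentalHole f R (p + 1) :=
    fundamentalHole_mono hM (by omega) (hq (mem_ball_zero_iff.2 hz1))
  have hcov : fundamentalHole f R (p + 1) ⊆ f '' A := by
    refine subset_of_disjoint_frontier isPreconnected_connectedComponentIn (hf.isOpenMap _ hAo)
      ⟨f z, hfz, z, ⟨hzp' rfl, hz2⟩, rfl⟩ ?_
    rw [Set.disjoint_left]
    intro y hy hyf
    obtain ⟨x, hx, rfl⟩ :=
      frontier_image_subset_image_frontier hf.1.continuous hf.isOpenMap hAo hAb hyf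
    exact fundamentalHole_subset_compl (p + 1) hy ((apply_mem_levelSet_iff hf hR hM).2 (hfrA hx))
  obtain ⟨y, hyA, hyc⟩ := hcov (fundamentalHole_mono hM p.le_succ (hp hc))
  refine hyA.2 (subset_closure (hp fun hy => hc ?_))
  rw [← hyc]
  exact (apply_mem_fastEscapingSet_iff hM).2 hy

-- Finitely many compact components could not cover the unbounded set A(f)^c.
include hf hR hM hweb in
theorem exists_seq_distinct_components : ∃ c : ℕ → ℂ, (∀ n, c n ∈ (fastEscapingSet f R)ᶜ) ∧
    ∀ m n, m ≠ n → connectedComponentIn (fastEscapingSet f R)ᶜ (c m) ≠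
      connectedComponentIn (fastEscapingSet f R)ᶜ (c n) := by
  have hsymm : Std.Symm fun x y => connectedComponentIn (fastEscapingSet f R)ᶜ x ≠
      connectedComponentIn (fastEscapingSet f R)ᶜ y := ⟨fun _ _ h => h.symm⟩
  obtain ⟨c, hc, hcd⟩ := exists_seq_of_forall_finset_exists'
    (fun z => z ∈ (fastEscapingSet f R)ᶜ)
    (fun x y => connectedComponentIn (fastEscapingSet f R)ᶜ x ≠
      connectedComponentIn (fastEscapingSet f R)ᶜ y) (by
    intro s hs
    by_contra! hall
    refine not_isBounded_compl_fastEscapingSet hf hR hM hweb (Bornology.IsBounded.subset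
      ((Bornology.isBounded_biUnion_finset s).2 fun x hx =>
        (isCompact_connectedComponentIn_compl_fastEscapingSet hf hR hM hweb (hs x hx)).isBounded)
      fun y hy => ?_)
    obtain ⟨x, hx, hxy⟩ := hall y hy
    exact Set.mem_iUnion₂.2 ⟨x, hx, hxy ▸ mem_connectedComponentIn hy⟩)
  exact ⟨c, hc, fun m n h => hcd h⟩

include hf hR hM hweb in
theorem exists_mem_ball_component_ne {z : ℂ} (hz : z ∈ juliaSet f) {ε : ℝ} (hε : 0 < ε)
    (s : Finset ℂ) : ∃ y ∈ Metric.ball z ε, y ∈ (fastEscapingSet f R)ᶜ ∧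
      ∀ x ∈ s, connectedComponentIn (fastEscapingSet f R)ᶜ x ≠
        connectedComponentIn (fastEscapingSet f R)ᶜ y := by
  classical
  obtain ⟨c, hcA, hcd⟩ := exists_seq_distinct_components hf hR hM hweb
  -- The radius ε/4 matches the quarter disc on which `exists_subseq_of_omits` gives convergence
  -- when two values are omitted on the disc of radius ε.
  have hnn : ¬ IsNormalFamilyOn (fun n => f^[n]) (Metric.ball z (ε / 4)) := fun h =>
    hz ⟨_, Metric.isOpen_ball, Metric.mem_ball_self (by positivity), h⟩
  rw [IsNormalFamilyOn] at hnn
  push Not at hnn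
  obtain ⟨φ, hφ⟩ := hnn
  have hpair : ∀ i j, i ≠ j → ∀ᶠ k in atTop, ∃ w ∈ Metric.ball z ε,
      f^[φ k] w = c i ∨ f^[φ k] w = c j := by
    intro i j hij
    by_contra hfr
    rw [not_eventually] at hfr
    obtain ⟨χ, hχ, hχo⟩ := extraction_of_frequently_atTop hfr
    push Not at hχo
    have hcij : c i ≠ c j := fun h => hcd i j hij (by rw [h])
    obtain ⟨ψ, hψ, hconv⟩ := exists_subseq_of_omits (u := fun k => f^[φ (χ k)]) hcij hε
      (fun n => (hf.1.iterate _).differentiableOn) (fun n w hw => (hχo n w hw).1)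
      (fun n w hw => (hχo n w hw).2)
    have := hφ (χ ∘ ψ) (hχ.comp hψ)
    rcases hconv with ⟨g, hg⟩ | hinf
    · exact this.1 g hg
    · exact this.2 hinf
  have hall : ∀ᶠ k in atTop, ∀ i ∈ Finset.range (s.card + 2), ∀ j ∈ Finset.range (s.card + 2),
      i ≠ j → ∃ w ∈ Metric.ball z ε, f^[φ k] w = c i ∨ f^[φ k] w = c j := by
    rw [Filter.eventually_all_finset]
    intro i _
    rw [Filter.eventually_all_finset]
    intro j _
    by_cases hij : i = j
    · simp [hij]
    · exact (hpair i j hij).mono fun _ h _ => h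
  obtain ⟨k, hk⟩ := hall.exists
  set T := (Finset.range (s.card + 2)).filter
    (fun i => ∃ w ∈ Metric.ball z ε, f^[φ k] w = c i) with hT
  -- Of any two of the `s.card + 2` points at least one is hit, so at most one is missed.
  have hTc : s.card < T.card := by
    have h1 := Finset.card_filter_add_card_filter_not (s := Finset.range (s.card + 2))
      (fun i => ∃ w ∈ Metric.ball z ε, f^[φ k] w = c i)
    have h2 : ((Finset.range (s.card + 2)).filter
        (fun i => ¬ ∃ w ∈ Metric.ball z ε, f^[φ k] w = c i)).card ≤ 1 := by
      rw [Finset.card_le_one]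
      intro i hi j hj
      rw [Finset.mem_filter] at hi hj
      by_contra hij
      obtain ⟨w, hw, h | h⟩ := hk i hi.1 j hj.1 hij
      · exact hi.2 ⟨w, hw, h⟩
      · exact hj.2 ⟨w, hw, h⟩
    rw [Finset.card_range, ← hT] at h1
    omega
  by_contra! hno
  have hsel : ∀ i ∈ T, ∃ x ∈ s, ∃ w ∈ (fastEscapingSet f R)ᶜ, f^[φ k] w = c i ∧
      connectedComponentIn (fastEscapingSet f R)ᶜ x =
        connectedComponentIn (fastEscapingSet f R)ᶜ w := by
    intro i hi
    obtain ⟨w, hw, hwc⟩ := (Finset.mem_filter.1 hi).2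
    have hwA : w ∈ (fastEscapingSet f R)ᶜ := fun h =>
      hcA i (hwc ▸ (iterate_mem_fastEscapingSet_iff hM (φ k)).2 h)
    obtain ⟨x, hx, hxw⟩ := hno w hw hwA
    exact ⟨x, hx, w, hwA, hwc, hxw⟩
  choose! x hxs w hwA hwc hxw using hsel
  -- If every preimage lay in a component met by `s`, two would share one, and its image would join
  -- c i to c j within A(f)^c.
  obtain ⟨i, hi, j, hj, hij, hxij⟩ := Finset.exists_ne_map_eq_of_card_lt_of_maps_to hTc hxs
  apply hcd i j hij
  have hmem : w j ∈ connectedComponentIn (fastEscapingSet f R)ᶜ (w i) := by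
    rw [← hxw i hi, hxij, hxw j hj]
    exact mem_connectedComponentIn (hwA j hj)
  have := iterate_image_connectedComponentIn_subset hM hf.1.continuous (hwA i hi) (φ k)
    ⟨w j, hmem, rfl⟩
  rw [hwc i hi, hwc j hj] at this
  exact connectedComponentIn_eq this

end Holes

/-! ### The main theorem -/

theorem theorem1p6 (f : ℂ → ℂ) (hf : IsTranscendentalEntire f)
    (R : ℝ) (hR : 0 < R) (hM : ∀ r : ℝ, R ≤ r → r < maxModulus f r)
    (hweb : IsSpidersWeb (levelSet f R)) :
    (∀ z ∈ (fastEscapingSet f R)ᶜ,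
      IsCompact (connectedComponentIn (fastEscapingSet f R)ᶜ z)) ∧
    (∀ z ∈ juliaSet f, ∃ u : ℕ → ℂ,
      (∀ n, u n ∈ (fastEscapingSet f R)ᶜ) ∧
      (∀ m n, m ≠ n → connectedComponentIn (fastEscapingSet f R)ᶜ (u m) ≠
        connectedComponentIn (fastEscapingSet f R)ᶜ (u n)) ∧
      Tendsto u atTop (𝓝 z)) := by
  refine ⟨fun z hz => isCompact_connectedComponentIn_compl_fastEscapingSet hf hR hM hweb hz,
    fun z hz => ?_⟩
  classical
  -- The natural number carried with each point sets its allowed distance to z; forcing it to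
  -- increase strictly yields convergence.
  obtain ⟨v, hv, hvd⟩ := exists_seq_of_forall_finset_exists
    (fun p : ℕ × ℂ => p.2 ∈ (fastEscapingSet f R)ᶜ ∧ dist p.2 z < 1 / ((p.1 : ℝ) + 1))
    (fun p q => p.1 < q.1 ∧ connectedComponentIn (fastEscapingSet f R)ᶜ p.2 ≠
      connectedComponentIn (fastEscapingSet f R)ᶜ q.2) (by
    intro s _
    obtain ⟨y, hy, hyA, hys⟩ := exists_mem_ball_component_ne hf hR hM hweb hz
      (Nat.one_div_pos_of_nat (α := ℝ) (n := s.sup Prod.fst + 1)) (s.image Prod.snd)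
    exact ⟨(s.sup Prod.fst + 1, y), ⟨hyA, hy⟩, fun p hp =>
      ⟨Nat.lt_succ_of_le (Finset.le_sup (f := Prod.fst) hp),
        hys _ (Finset.mem_image_of_mem _ hp)⟩⟩)
  have hmono : StrictMono fun n => (v n).1 := fun m n h => (hvd m n h).1
  refine ⟨fun n => (v n).2, fun n => (hv n).1, fun m n hmn => ?_, ?_⟩
  · rcases lt_or_gt_of_ne hmn with h | h
    · exact (hvd m n h).2
    · exact (hvd n m h).2.symm
  · rw [tendsto_iff_dist_tendsto_zero]
    exact squeeze_zero (fun _ => dist_nonneg) (fun n => (hv n).2.le)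
      (tendsto_one_div_add_atTop_nhds_zero_nat.comp hmono.tendsto_atTop)
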